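/- **Setting.** A unit mass of agents have valuations $\theta$ drawn from the uniform distribution on $[0,1]$, with distribution function $F(\theta)=\theta$ and density $f=1$; write $\mathcal C(\theta)=\theta+F(\theta)/f(\theta)$ and $\mathcal V(\theta)=\theta-(1-F(\theta))/f(\theta)$. Each agent owns one unit of an indivisible good and demands two. A designer announces a direct mechanism $(q,t)$ with $q:[0,1]\to\{-1,0,1\}$ and $t:[0,1]\to\mathbb R$; a type $\theta$ who reports $r$ gets $\theta q(r)-t(r)$, and the mechanism is incentive compatible. Each agent then joins the mechanism, or the decentralized market, or neither (payoff $0$). In the decentralized market an agent is matched with probability $p\in[0,1]$ to a partner whose valuation is drawn from $F$ conditional on the set of types in that market. A matched pair plays a double auction: both bid, and the higher bidder buys the other's unit at the midpoint of the two bids (ties are broken by a fair coin). Bids are given by a bidding function with finite expectation. A *simple outcome* with cutoffs $0\le\underline\theta<\overline\theta\le1$ consists of such a mechanism, market choices and a bidding function such that exactly the types in $(\underline\theta,\overline\theta)$ join the decentralized market; the total of $q$ over the agents who join the mechanism is at most $0$; every type's bid is optimal for it, given the bids of the types in the decentralized market; every type's choice of market is optimal given everyone else's strategy; and no pair of agents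 would both gain by moving to a market together. A *simple equilibrium* is a simple outcome that maximizes the designer's profit $\int t\,dF$ over the agents who join the mechanism, among all simple outcomes for the same $p$ (over all cutoffs). **Theorem.** There exist $0<\underline\theta<\overline\theta<1$ with $\mathcal C(\underline\theta)=\mathcal V(\overline\theta)$ and $F(\underline\theta)=1-F(\overline\theta)$ such that: 1. for every $p\in[0,1]$ there is a simple equilibrium with cutoffs $\underline\theta,\overline\theta$ in which exactly the types in $[0,\underline\theta]\cup[\overline\theta,1]$ join the mechanism and exactly the types in $(\underline\theta,\overline\theta)$ join the decentralized market with double auction; 2. for every $p\in(0,1]$, every simple equilibrium has these cutoffs $\underline\theta,\overline\theta$, and in it exactly the types in $[0,\underline\theta]\cup[\overline\theta,1]$ join the mechanism and exactly the types in $(\underline\theta,\overline\theta)$ join the decentralized market. -/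

import Mathlib

open MeasureTheory

noncomputable section

/-- The law on `ℝ` of an agent's valuation when the valuations have density `f`. -/
def valuationLaw (f : ℝ → ℝ) : Measure ℝ :=
  volume.withDensity fun x => ENNReal.ofReal (f x)

/-- The distribution function `F` of the valuations. -/
def valuationCDF (f : ℝ → ℝ) (x : ℝ) : ℝ :=
  (valuationLaw f).real (Set.Iic x)

/-- The virtual cost `C(θ) = θ + F(θ) / f(θ)`. -/
def virtualCost (f : ℝ → ℝ) (θ : ℝ) : ℝ :=
  θ + valuationCDF f θ / f θ

/-- The virtual value `V(θ) = θ - (1 - F(θ)) / f(θ)`. -/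
def virtualValue (f : ℝ → ℝ) (θ : ℝ) : ℝ :=
  θ - (1 - valuationCDF f θ) / f θ

/-- The density of the uniform distribution on `[0, 1]`. -/
def uniformDensity : ℝ → ℝ :=
  (Set.Icc (0 : ℝ) 1).indicator fun _ => 1

/-- What an agent can do after the designer has announced a mechanism. -/
inductive MarketChoice where
  /-- join the designer's mechanism (the centralized marketplace) -/
  | mechanism
  /-- join the decentralized market with double auction -/
  | doubleAuction
  /-- join neither market -/
  | neither

/-- The gain from trade, in a double auction, of an agent with valuation `θ` who bids `β` and whose
partner bids `β'`. The higher bidder buys the other's unit at the midpoint of the two bids. Equal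
bids are resolved by a fair coin, which leaves an expected gain of
`((θ - β) + (β - θ)) / 2 = 0`. -/
def doubleAuctionGain (θ β β' : ℝ) : ℝ :=
  if β' < β then θ - (β + β') / 2
  else if β < β' then (β + β') / 2 - θ
  else 0

/-- A direct mechanism `(q, t)` announced by the designer together with the agents' strategies: the
market they choose and the bid they place if they are matched in the double-auction market, both as
functions of the valuation in `[0, 1]`. Values at reals outside `[0, 1]` play no role. -/
structure MarketOutcome where
  /-- the quantity received (negative if sold) by an agent who reports a given valuation -/
  q : ℝ → ℝ
  /-- the payment made (negative if received) by an agent who reports a given valuation -/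
  t : ℝ → ℝ
  /-- the market joined -/
  choice : ℝ → MarketChoice
  /-- the bid in the double auction -/
  bid : ℝ → ℝ

namespace MarketOutcome

/-- The set of types in `[0, 1]` that make the choice `c`. -/
def joiners (O : MarketOutcome) (c : MarketChoice) : Set ℝ :=
  {θ | θ ∈ Set.Icc (0 : ℝ) 1 ∧ O.choice θ = c}

/-- The utility in the mechanism of an agent with valuation `θ` who reports `r`. -/
def mechanismUtility (O : MarketOutcome) (θ r : ℝ) : ℝ :=
  θ * min 1 (O.q r) - O.t r

/-- The distribution of the valuation of a random partner in the decentralized market: the law of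
the valuations conditional on the set of types who join that market. -/
def partnerLaw (f : ℝ → ℝ) (O : MarketOutcome) : Measure ℝ :=
  ProbabilityTheory.cond (valuationLaw f) (O.joiners .doubleAuction)

/-- The expected gain, conditional on being matched, of an agent with valuation `θ` who bids `β` in
the double-auction market. -/
def auctionPayoff (f : ℝ → ℝ) (O : MarketOutcome) (θ β : ℝ) : ℝ :=
  ∫ x, doubleAuctionGain θ β (O.bid x) ∂(O.partnerLaw f)

/-- The expected payoff of an agent with valuation `θ` from each choice, the strategies of all
others being given; `p` is the probability of finding a match in the decentralized market. A single
agent or a pair of agents has measure zero and does not change these payoffs. -/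
def payoff (f : ℝ → ℝ) (p : ℝ) (O : MarketOutcome) (θ : ℝ) : MarketChoice → ℝ
  | .mechanism => O.mechanismUtility θ θ
  | .doubleAuction => p * O.auctionPayoff f θ (O.bid θ)
  | .neither => 0

/-- The profit of the designer: the total payments of the agents who join the mechanism. -/
def profit (f : ℝ → ℝ) (O : MarketOutcome) : ℝ :=
  ∫ θ in O.joiners .mechanism, O.t θ ∂(valuationLaw f)

/-- The announced mechanism is admissible and the agents' strategies are an equilibrium of the
market choice game that follows the announcement. -/
structure IsMarketEquilibrium (f : ℝ → ℝ) (p : ℝ) (O : MarketOutcome) : Prop where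
  /-- the good is indivisible and each agent owns one unit and demands two -/
  indivisible : ∀ θ ∈ Set.Icc (0 : ℝ) 1, O.q θ ∈ ({-1, 0, 1} : Set ℝ)
  /-- incentive compatibility -/
  incentive_compatible : ∀ θ ∈ Set.Icc (0 : ℝ) 1, ∀ r ∈ Set.Icc (0 : ℝ) 1,
    O.mechanismUtility θ r ≤ O.mechanismUtility θ θ
  measurable_joiners : MeasurableSet (O.joiners .mechanism)
  /-- the designer does not sell more than she buys -/
  market_clearing : ∫ θ in O.joiners .mechanism, O.q θ ∂(valuationLaw f) ≤ 0
  integrable_bid : Integrable O.bid (O.partnerLaw f)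
  /-- every type, also one who is not supposed to join the double-auction market, would bid
  optimally there -/
  bid_optimal : ∀ θ ∈ Set.Icc (0 : ℝ) 1, ∀ β : ℝ,
    O.auctionPayoff f θ β ≤ O.auctionPayoff f θ (O.bid θ)
  /-- no agent prefers another choice; this contains individual rationality -/
  choice_optimal : ∀ θ ∈ Set.Icc (0 : ℝ) 1, ∀ c : MarketChoice,
    O.payoff f p θ c ≤ O.payoff f p θ (O.choice θ)
  /-- no pair of agents prefers to move to a market together -/
  no_bilateral_deviation : ∀ θ₁ ∈ Set.Icc (0 : ℝ) 1, ∀ θ₂ ∈ Set.Icc (0 : ℝ) 1,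
    ∀ c : MarketChoice,
      ¬ (O.payoff f p θ₁ (O.choice θ₁) < O.payoff f p θ₁ c ∧
        O.payoff f p θ₂ (O.choice θ₂) < O.payoff f p θ₂ c)

/-- The outcome is a market equilibrium in which precisely the types in the nonempty open interval
`(a, b)` join the decentralized market. -/
structure IsSimpleOutcome (f : ℝ → ℝ) (p a b : ℝ) (O : MarketOutcome) : Prop where
  equilibrium : O.IsMarketEquilibrium f p
  nonneg : 0 ≤ a
  lt : a < b
  le_one : b ≤ 1
  searchers : O.joiners .doubleAuction = Set.Ioo a b

/-- A simple equilibrium with cutoffs `a` and `b`: moreover the designer has chosen the mechanism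
and the cutoffs so that no other simple outcome gives her a higher profit. -/
structure IsSimpleEquilibrium (f : ℝ → ℝ) (p a b : ℝ) (O : MarketOutcome) : Prop where
  simple : O.IsSimpleOutcome f p a b
  profit_maximal : ∀ (a' b' : ℝ) (O' : MarketOutcome),
    O'.IsSimpleOutcome f p a' b' → O'.profit f ≤ O.profit f

end MarketOutcome

end

noncomputable section

/-! ### Double auctions with an arbitrary law of the partner's valuation -/

/-! The key fact is a revenue-equivalence statement: optimal bidding determines all payoffs of the
decentralized market on `[a, b]`, whatever the bidding function is. For a fixed bid the expected
gain is affine in the valuation, with slope P(buy) - P(sell). The optimal payoff `V` is therefore an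
upper envelope of affine functions, and the slope at the optimal bid is a subgradient. A bid that
ties with positive probability must equal the bidder's valuation, so ties are null under an atomless
law. Together with monotonicity of the slope this forces bids to be ordered like valuations almost
surely (`sign_bid_sub_ae_eq`). For uniform partners on `(a, b)` the slope is then affine and `V` is
quadratic. Its constant comes from budget balance: payments within a pair cancel on average. Hence
`V` is `(b - a) / 12` at the midpoint and `(b - a) / 3` at both ends (`uniform_auction_payoffs`).

If `p > 0`, the cutoffs determine everything that matters in a simple outcome (`structure_of_pos`).
Staying out is worse than searching. Types above `b` buy and types below `a` sell. Indifference at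
the cutoffs fixes the prices `b - p(b - a)/3` and `a + p(b - a)/3`, and market clearing becomes `1 -
b ≤ a`. The profit is an explicit polynomial, maximized only at `(1/4, 3/4)`, with value `(1 -
2p/3)/8`.

The explicit outcome `candidate p` attains this value. If `p = 0`, the argument fixing the prices is
not available; a Lagrangian bound from individual rationality and market clearing gives profit at
most `1/8`, which the candidate also attains. -/

theorem measurable_realSign : Measurable Real.sign :=
  Measurable.ite measurableSet_Iio measurable_const
    (Measurable.ite measurableSet_Ioi measurable_const measurable_const)

theorem abs_realSign_le_one (x : ℝ) : |Real.sign x| ≤ 1 := by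
  rcases Real.sign_apply_eq x with h | h | h <;> simp [h]

theorem monotone_realSign : Monotone Real.sign := by
  intro x y h
  rcases lt_trichotomy x 0 with hx | hx | hx
  · rw [Real.sign_of_neg hx]; exact neg_le_of_abs_le (abs_realSign_le_one y)
  · subst hx
    rcases h.lt_or_eq with hy | hy
    · rw [Real.sign_of_pos hy, Real.sign_zero]; norm_num
    · rw [hy]
  · rw [Real.sign_of_pos hx, Real.sign_of_pos (hx.trans_le h)]

/-- Separates trade from payment: the sign is the traded quantity, and its value 0 at 0 agrees with
the zero expected gain from a tie. The gain is thus affine in the valuation. -/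
theorem doubleAuctionGain_eq (θ β β' : ℝ) :
    doubleAuctionGain θ β β' =
      θ * Real.sign (β - β') - (β + β') / 2 * Real.sign (β - β') := by
  unfold doubleAuctionGain
  rcases lt_trichotomy β β' with h | h | h
  · rw [if_neg h.not_gt, if_pos h, Real.sign_of_neg (sub_neg.2 h)]; ring
  · simp [h]
  · rw [if_pos h, Real.sign_of_pos (sub_pos.2 h)]; ring

section General

variable {μ : Measure ℝ} {X : ℝ → ℝ}

theorem aestronglyMeasurable_sign (hX : Integrable X μ) (β : ℝ) :
    AEStronglyMeasurable (fun x => Real.sign (β - X x)) μ :=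
  (measurable_realSign.comp_aemeasurable
    (aemeasurable_const.sub hX.aemeasurable)).aestronglyMeasurable

variable [IsProbabilityMeasure μ]

theorem integrable_sign (hX : Integrable X μ) (β : ℝ) :
    Integrable (fun x => Real.sign (β - X x)) μ :=
  Integrable.of_bound (aestronglyMeasurable_sign hX β) 1
    (Filter.Eventually.of_forall fun _ => abs_realSign_le_one _)

theorem integrable_midpoint_mul_sign (hX : Integrable X μ) (β : ℝ) :
    Integrable (fun x => (β + X x) / 2 * Real.sign (β - X x)) μ :=
  Integrable.mul_bdd (c := 1) (((integrable_const β).add hX).div_const 2)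
    (aestronglyMeasurable_sign hX β)
    (Filter.Eventually.of_forall fun _ => abs_realSign_le_one _)

theorem integrable_doubleAuctionGain (hX : Integrable X μ) (θ β : ℝ) :
    Integrable (fun x => doubleAuctionGain θ β (X x)) μ := by
  simp_rw [doubleAuctionGain_eq]
  exact ((integrable_sign hX β).const_mul θ).sub (integrable_midpoint_mul_sign hX β)

theorem integral_doubleAuctionGain (hX : Integrable X μ) (θ β : ℝ) :
    ∫ x, doubleAuctionGain θ β (X x) ∂μ = θ * ∫ x, Real.sign (β - X x) ∂μ -
      ∫ x, (β + X x) / 2 * Real.sign (β - X x) ∂μ := by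
  simp_rw [doubleAuctionGain_eq]
  rw [integral_sub ((integrable_sign hX β).const_mul θ) (integrable_midpoint_mul_sign hX β),
    integral_const_mul]

theorem integral_sign_bounds (X : ℝ → ℝ) (β : ℝ) :
    -1 ≤ ∫ x, Real.sign (β - X x) ∂μ ∧ ∫ x, Real.sign (β - X x) ∂μ ≤ 1 := by
  have h := norm_integral_le_of_norm_le_const (μ := μ) (f := fun x => Real.sign (β - X x)) (C := 1)
    (Filter.Eventually.of_forall fun _ => abs_realSign_le_one _)
  simp only [probReal_univ, mul_one, Real.norm_eq_abs] at h
  exact abs_le.1 h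

/-- The slope of the optimal payoff of a bidder is the difference between the probabilities of
buying and selling. -/
theorem payoff_subgradient (hX : Integrable X μ) {I : Set ℝ}
    (hopt : ∀ θ ∈ I, ∀ β, ∫ x, doubleAuctionGain θ β (X x) ∂μ ≤
      ∫ x, doubleAuctionGain θ (X θ) (X x) ∂μ) {θ : ℝ} (hθ : θ ∈ I) (θ' : ℝ) :
    ∫ x, doubleAuctionGain θ' (X θ') (X x) ∂μ +
      (∫ x, Real.sign (X θ' - X x) ∂μ) * (θ - θ') ≤ ∫ x, doubleAuctionGain θ (X θ) (X x) ∂μ := by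
  -- Type `θ` imitates the bid of type `θ'`.
  have h := hopt θ hθ (X θ')
  rw [integral_doubleAuctionGain hX θ] at h
  rw [integral_doubleAuctionGain hX θ']
  linarith

/-- Adding the two imitation inequalities for a pair of types cancels the payoffs, as in the usual
proof that incentive compatible allocations are monotone. -/
theorem sign_integral_monotoneOn (hX : Integrable X μ) {I : Set ℝ}
    (hopt : ∀ θ ∈ I, ∀ β, ∫ x, doubleAuctionGain θ β (X x) ∂μ ≤
      ∫ x, doubleAuctionGain θ (X θ) (X x) ∂μ) :
    MonotoneOn (fun θ => ∫ x, Real.sign (X θ - X x) ∂μ) I := by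
  intro θ hθ θ' hθ' hle
  rcases hle.eq_or_lt with h | h
  · rw [h]
  have h1 := payoff_subgradient hX hopt hθ θ'
  have h2 := payoff_subgradient hX hopt hθ' θ
  by_contra! hc
  have := mul_pos (sub_pos.2 hc) (sub_pos.2 h)
  linarith

/-! ### Ties in the double auction -/

/-- The effect on the gain from trade of raising a bid by an arbitrarily small amount. -/
theorem tendsto_gain_raise (θ β y : ℝ) :
    Filter.Tendsto (fun ε => doubleAuctionGain θ (β + ε) y) (nhdsWithin 0 (Set.Ioi 0))
      (nhds (doubleAuctionGain θ β y + ({y | y = β} : Set ℝ).indicator (fun _ => θ - β) y)) := by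
  have hid : Filter.Tendsto (fun ε : ℝ => ε) (nhdsWithin 0 (Set.Ioi 0)) (nhds 0) :=
    tendsto_nhdsWithin_of_tendsto_nhds Filter.tendsto_id
  rcases lt_trichotomy β y with h | h | h
  · have e : doubleAuctionGain θ β y + ({y | y = β} : Set ℝ).indicator (fun _ => θ - β) y =
        (β + 0 + y) / 2 - θ := by
      simp [doubleAuctionGain, h, h.not_gt, h.ne']
    rw [e]
    refine Filter.Tendsto.congr' ?_ ((((hid.const_add β).add_const y).div_const 2).sub_const θ)
    filter_upwards [hid.eventually (gt_mem_nhds (sub_pos.2 h))] with ε hε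
    have : β + ε < y := by linarith
    simp [doubleAuctionGain, this, this.not_gt]
  · subst h
    have e : doubleAuctionGain θ β β + ({y | y = β} : Set ℝ).indicator (fun _ => θ - β) β =
        θ - (β + 0 + β) / 2 := by
      simp [doubleAuctionGain]
    rw [e]
    refine Filter.Tendsto.congr' ?_ ((((hid.const_add β).add_const β).div_const 2).const_sub θ)
    filter_upwards [self_mem_nhdsWithin] with ε hε
    have : β < β + ε := by simpa using hε
    simp [doubleAuctionGain, this]
  · have e : doubleAuctionGain θ β y + ({y | y = β} : Set ℝ).indicator (fun _ => θ - β) y =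
        θ - (β + 0 + y) / 2 := by
      simp [doubleAuctionGain, h, h.ne]
    rw [e]
    refine Filter.Tendsto.congr' ?_ ((((hid.const_add β).add_const y).div_const 2).const_sub θ)
    filter_upwards [self_mem_nhdsWithin] with ε hε
    have : y < β + ε := by have : 0 < ε := hε; linarith
    simp [doubleAuctionGain, this]

/-- Reflection exchanges buying and selling, so arguments about raising a bid also cover lowering
it. -/
theorem doubleAuctionGain_neg (θ β y : ℝ) :
    doubleAuctionGain (-θ) (-β) (-y) = doubleAuctionGain θ β y := by
  unfold doubleAuctionGain
  rcases lt_trichotomy β y with h | h | h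
  · simp [h, h.not_gt]; ring
  · simp [h]
  · simp [h, h.not_gt]; ring

theorem abs_doubleAuctionGain_le (θ β y : ℝ) :
    |doubleAuctionGain θ β y| ≤ |θ| + |β| + |y| := by
  unfold doubleAuctionGain
  have h1 := abs_le.1 (le_refl |θ|)
  have h2 := abs_le.1 (le_refl |β|)
  have h3 := abs_le.1 (le_refl |y|)
  have := abs_nonneg β
  have := abs_nonneg y
  have := abs_nonneg θ
  split_ifs <;> rw [abs_le] <;> constructor <;> linarith

/-- An infinitesimal overbid wins every tie and changes nothing else in the limit, so it would gain
`θ - β` on the tie event. Dominated convergence makes this exact. -/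
theorem tie_gain_nonpos (hX : Integrable X μ) {θ β : ℝ}
    (hopt : ∀ β', ∫ x, doubleAuctionGain θ β' (X x) ∂μ ≤ ∫ x, doubleAuctionGain θ β (X x) ∂μ) :
    (θ - β) * μ.real {x | X x = β} ≤ 0 := by
  have hnull : NullMeasurableSet {x | X x = β} μ :=
    hX.aemeasurable.nullMeasurable (measurableSet_singleton β)
  have hlim : Filter.Tendsto (fun ε => ∫ x, doubleAuctionGain θ (β + ε) (X x) ∂μ)
      (nhdsWithin 0 (Set.Ioi 0)) (nhds (∫ x, (doubleAuctionGain θ β (X x) +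
        ({y | y = β} : Set ℝ).indicator (fun _ => θ - β) (X x)) ∂μ)) := by
    refine tendsto_integral_filter_of_dominated_convergence (fun x => |θ| + (|β| + 1) + |X x|)
      (Filter.Eventually.of_forall fun ε => (integrable_doubleAuctionGain hX _ _).1) ?_
      ((integrable_const _).add hX.abs) (Filter.Eventually.of_forall fun x =>
        tendsto_gain_raise θ β (X x))
    have : ∀ᶠ ε : ℝ in nhdsWithin 0 (Set.Ioi 0), ε < 1 :=
      (tendsto_nhdsWithin_of_tendsto_nhds Filter.tendsto_id).eventually (gt_mem_nhds one_pos)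
    filter_upwards [self_mem_nhdsWithin, this] with ε hε hε1
    refine Filter.Eventually.of_forall fun x => (abs_doubleAuctionGain_le _ _ _).trans ?_
    have h1 := abs_add_le β ε
    rw [abs_of_pos (show (0 : ℝ) < ε from hε)] at h1
    linarith
  have hle := le_of_tendsto' hlim fun ε => hopt (β + ε)
  have hind : (fun x => ({y | y = β} : Set ℝ).indicator (fun _ => θ - β) (X x)) =
      {x | X x = β}.indicator fun _ => θ - β := rfl
  have hint : Integrable ({x | X x = β}.indicator fun _ => θ - β) μ :=
    (integrable_const _).indicator₀ hnull
  rw [integral_add (integrable_doubleAuctionGain hX _ _) (hind ▸ hint), hind,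
    integral_indicator₀ hnull, setIntegral_const, smul_eq_mul] at hle
  linarith

/-- A type who bids optimally and ties with positive probability bids its valuation. -/
theorem bid_eq_of_tie (hX : Integrable X μ) {θ β : ℝ}
    (hopt : ∀ β', ∫ x, doubleAuctionGain θ β' (X x) ∂μ ≤ ∫ x, doubleAuctionGain θ β (X x) ∂μ)
    (htie : μ {x | X x = β} ≠ 0) : θ = β := by
  have hpos : 0 < μ.real {x | X x = β} :=
    ENNReal.toReal_pos htie (measure_ne_top _ _)
  have h1 := tie_gain_nonpos hX hopt
  have h2 := tie_gain_nonpos (μ := μ) (X := fun x => -X x) (θ := -θ) (β := -β) hX.neg (by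
    intro β'
    have := hopt (-β')
    rw [← neg_neg β']
    simpa only [doubleAuctionGain_neg] using this)
  simp only [neg_inj] at h2
  have h3 : θ - β ≤ 0 := by by_contra! h; exact absurd (mul_pos h hpos) h1.not_gt
  have h4 : -θ - -β ≤ 0 := by by_contra! h; exact absurd (mul_pos h hpos) h2.not_gt
  linarith

/-- An atom of the bid distribution at `β` would consist of types who all tie with positive
probability, hence all have valuation `β`; a single valuation has no mass. -/
theorem measure_bid_eq_zero [NullSingletonClass μ] (hX : Integrable X μ) {I : Set ℝ} (hI : ∀ᵐ x ∂μ, x ∈ I)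
    (hopt : ∀ θ ∈ I, ∀ β, ∫ x, doubleAuctionGain θ β (X x) ∂μ ≤
      ∫ x, doubleAuctionGain θ (X θ) (X x) ∂μ) (β : ℝ) :
    μ {x | X x = β} = 0 := by
  by_contra htie
  refine htie ?_
  rw [measure_eq_zero_iff_ae_notMem]
  have hβ : ∀ᵐ x ∂μ, x ≠ β := by
    simp [ae_iff]
  filter_upwards [hI, hβ] with x hx hxβ hmem
  have hmem : X x = β := hmem
  refine hxβ (bid_eq_of_tie hX (fun β' => ?_) htie)
  have := hopt x hx β'
  rwa [hmem] at this

/-! ### Bids are ordered like valuations -/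

/-- Almost no values of a function lie above `β` without leaving mass in between. -/
theorem measure_no_mass_between {α : Type*} [MeasurableSpace α] (ν : Measure α) (Y : α → ℝ)
    (β : ℝ) : ν {x | β < Y x ∧ ν {y | β < Y y ∧ Y y ≤ Y x} = 0} = 0 := by
  set N := {x | β < Y x ∧ ν {y | β < Y y ∧ Y y ≤ Y x} = 0} with hN
  -- If `Y` has a largest value on `N`, the null interval ending there contains `N`. Otherwise the
  -- null intervals with rational upper ends suffice, and they are countably many.
  by_cases hmax : ∃ x ∈ N, ∀ x' ∈ N, Y x' ≤ Y x
  · obtain ⟨x, hx, hmax⟩ := hmax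
    have hsub : N ⊆ {y | β < Y y ∧ Y y ≤ Y x} := fun y hy => ⟨hy.1, hmax y hy⟩
    exact measure_mono_null hsub hx.2
  · push Not at hmax
    have hU : ν (⋃ r : ℚ, {y | ν {y | β < Y y ∧ Y y ≤ r} = 0 ∧ β < Y y ∧ Y y ≤ r}) = 0 := by
      refine measure_iUnion_null fun r => ?_
      by_cases h : ν {y | β < Y y ∧ Y y ≤ r} = 0
      · simp [h]
      · simp [h]
    refine measure_mono_null (fun x hx => ?_) hU
    obtain ⟨x', hx', hlt⟩ := hmax x hx
    obtain ⟨r, h1, h2⟩ := exists_rat_btwn hlt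
    refine Set.mem_iUnion.2 ⟨r, measure_mono_null (fun y hy => ?_) hx'.2, hx.1, h1.le⟩
    exact ⟨hy.1, hy.2.trans h2.le⟩

/-- If two bids have the same balance of buying and selling probabilities, then almost no bids
lie in between. -/
theorem measure_between_eq_zero (hX : Integrable X μ) {β β' : ℝ} (hlt : β ≤ β')
    (hle : ∫ x, Real.sign (β' - X x) ∂μ ≤ ∫ x, Real.sign (β - X x) ∂μ) :
    ∀ᵐ x ∂μ, ¬ (β < X x ∧ X x ≤ β') ∧ ¬ (β ≤ X x ∧ X x < β') := by
  have hnn : 0 ≤ fun x => Real.sign (β' - X x) - Real.sign (β - X x) := fun x =>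
    sub_nonneg.2 (monotone_realSign (sub_le_sub_right hlt _))
  have hint := (integrable_sign hX β').sub (integrable_sign hX β)
  have hz : ∫ x, (Real.sign (β' - X x) - Real.sign (β - X x)) ∂μ = 0 := by
    refine le_antisymm ?_ (integral_nonneg hnn)
    rw [integral_sub (integrable_sign hX β') (integrable_sign hX β)]
    linarith
  filter_upwards [(integral_eq_zero_iff_of_nonneg hnn hint).1 hz] with x hx
  simp only [Pi.zero_apply] at hx
  constructor
  · rintro ⟨h1, h2⟩
    have h3 := monotone_realSign (sub_nonneg.2 h2)
    rw [Real.sign_of_neg (sub_neg.2 h1)] at hx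
    rw [Real.sign_zero] at h3
    linarith
  · rintro ⟨h1, h2⟩
    have h3 := monotone_realSign (sub_nonpos.2 h1)
    rw [Real.sign_of_pos (sub_pos.2 h2)] at hx
    rw [Real.sign_zero] at h3
    linarith

/-- Optimal bids are ordered in the same way as the valuations. -/
theorem sign_bid_sub_ae_eq [NullSingletonClass μ] (hX : Integrable X μ) {I : Set ℝ} (hI : ∀ᵐ x ∂μ, x ∈ I)
    (hopt : ∀ θ ∈ I, ∀ β, ∫ x, doubleAuctionGain θ β (X x) ∂μ ≤
      ∫ x, doubleAuctionGain θ (X θ) (X x) ∂μ) {θ : ℝ} (hθ : θ ∈ I) :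
    ∀ᵐ x ∂μ, Real.sign (X θ - X x) = Real.sign (θ - x) := by
  have hne : ∀ᵐ x ∂μ, x ≠ θ := by simp [ae_iff]
  have hbid : ∀ᵐ x ∂μ, X x ≠ X θ := by
    simpa [ae_iff] using measure_bid_eq_zero hX hI hopt (X θ)
  have hup := measure_eq_zero_iff_ae_notMem.1 (measure_no_mass_between μ X (X θ))
  have hdown := measure_eq_zero_iff_ae_notMem.1
    (measure_no_mass_between μ (fun x => -X x) (-X θ))
  have hmono := sign_integral_monotoneOn hX hopt
  filter_upwards [hI, hne, hbid, hup, hdown] with x hxI hxθ hxb hxu hxd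
  rcases lt_or_gt_of_ne hxθ with h | h
  · rcases lt_or_gt_of_ne hxb with h' | h'
    · rw [Real.sign_of_pos (sub_pos.2 h), Real.sign_of_pos (sub_pos.2 h')]
    -- Here the lower type bids more. Monotonicity in the type and in the bid then makes the two
    -- slopes equal, so no mass of bids lies in between, which excludes almost every such `x`.
    · refine absurd ⟨h', ?_⟩ hxu
      rw [measure_eq_zero_iff_ae_notMem]
      filter_upwards [measure_between_eq_zero hX h'.le (hmono hxI hθ h.le)] with y hy
      exact hy.1
  · rcases lt_or_gt_of_ne hxb with h' | h'
    · refine absurd ⟨neg_lt_neg h', ?_⟩ hxd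
      rw [measure_eq_zero_iff_ae_notMem]
      filter_upwards [measure_between_eq_zero hX h'.le (hmono hθ hxI h.le)] with y hy hy'
      exact hy.2 ⟨neg_le_neg_iff.1 hy'.2, neg_lt_neg_iff.1 hy'.1⟩
    · rw [Real.sign_of_neg (sub_neg.2 h), Real.sign_of_neg (sub_neg.2 h')]

/-- The payments between the partners in the double auction are balanced. -/
theorem integral_integral_payment_eq_zero (hX : Integrable X μ) :
    ∫ x, ∫ y, (X x + X y) / 2 * Real.sign (X x - X y) ∂μ ∂μ = 0 := by
  have hint : Integrable (Function.uncurry fun x y => (X x + X y) / 2 * Real.sign (X x - X y))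
      (μ.prod μ) := by
    have h1 : Integrable (fun z : ℝ × ℝ => X z.1) (μ.prod μ) := hX.comp_fst μ
    have h2 : Integrable (fun z : ℝ × ℝ => X z.2) (μ.prod μ) := hX.comp_snd μ
    exact Integrable.mul_bdd (c := 1) ((h1.add h2).div_const 2)
      (measurable_realSign.comp_aemeasurable
        (h1.aemeasurable.sub h2.aemeasurable)).aestronglyMeasurable
      (Filter.Eventually.of_forall fun _ => abs_realSign_le_one _)
  have hswap := integral_integral_swap hint
  have hanti : ∀ x y, (X x + X y) / 2 * Real.sign (X x - X y) =
      -((X y + X x) / 2 * Real.sign (X y - X x)) := by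
    intro x y
    rw [← neg_sub (X y) (X x), Real.sign_neg]; ring
  have : ∫ y, ∫ x, (X x + X y) / 2 * Real.sign (X x - X y) ∂μ ∂μ =
      -∫ x, ∫ y, (X x + X y) / 2 * Real.sign (X x - X y) ∂μ ∂μ := by
    rw [← integral_neg]
    congr 1
    ext y
    rw [← integral_neg]
    congr 1
    ext x
    exact hanti x y
  linarith

end General

/-! ### Uniformly distributed valuations -/

theorem valuationLaw_uniform :
    valuationLaw uniformDensity = volume.restrict (Set.Icc 0 1) := by
  have : (fun x => ENNReal.ofReal (uniformDensity x)) = (Set.Icc (0 : ℝ) 1).indicator 1 := by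
    ext x
    by_cases h : x ∈ Set.Icc (0 : ℝ) 1 <;> simp [uniformDensity, h]
  rw [valuationLaw, this, withDensity_indicator_one measurableSet_Icc]

theorem valuationCDF_uniform {x : ℝ} (h0 : 0 ≤ x) (h1 : x ≤ 1) :
    valuationCDF uniformDensity x = x := by
  have : Set.Iic x ∩ Set.Icc 0 1 = Set.Icc 0 x := by
    ext y
    simp only [Set.mem_inter_iff, Set.mem_Iic, Set.mem_Icc]
    constructor
    · rintro ⟨h, h', -⟩; exact ⟨h', h⟩
    · rintro ⟨h, h'⟩; exact ⟨h', h, h'.trans h1⟩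
  rw [valuationCDF, valuationLaw_uniform, measureReal_restrict_apply measurableSet_Iic, this,
    Real.volume_real_Icc_of_le h0, sub_zero]

theorem uniformDensity_eq_one {x : ℝ} (h0 : 0 ≤ x) (h1 : x ≤ 1) : uniformDensity x = 1 := by
  simp [uniformDensity, h0, h1]

/-- The uniform distribution on an interval. -/
theorem cond_uniform_Ioo {a b : ℝ} (h0 : 0 ≤ a) (h1 : b ≤ 1) :
    ProbabilityTheory.cond (valuationLaw uniformDensity) (Set.Ioo a b) =
      (ENNReal.ofReal (b - a))⁻¹ • volume.restrict (Set.Ioo a b) := by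
  have hsub : Set.Ioo a b ⊆ Set.Icc 0 1 := fun x hx => ⟨h0.trans hx.1.le, hx.2.le.trans h1⟩
  rw [ProbabilityTheory.cond, valuationLaw_uniform, Measure.restrict_restrict_of_subset hsub,
    Measure.restrict_apply measurableSet_Ioo, Set.inter_eq_left.2 hsub, Real.volume_Ioo]

theorem isProbabilityMeasure_cond_uniform_Ioo {a b : ℝ} (h0 : 0 ≤ a) (hab : a < b) (h1 : b ≤ 1) :
    IsProbabilityMeasure
      (ProbabilityTheory.cond (valuationLaw uniformDensity) (Set.Ioo a b)) := by
  constructor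
  rw [cond_uniform_Ioo h0 h1]
  simp only [Measure.smul_apply, Measure.restrict_apply_univ, Real.volume_Ioo, smul_eq_mul]
  exact ENNReal.inv_mul_cancel (by simpa using hab) ENNReal.ofReal_ne_top

theorem nullSingletonClass_cond_uniform_Ioo {a b : ℝ} (h0 : 0 ≤ a) (h1 : b ≤ 1) :
    NullSingletonClass
      (ProbabilityTheory.cond (valuationLaw uniformDensity) (Set.Ioo a b)) := by
  constructor
  intro x
  rw [cond_uniform_Ioo h0 h1]
  simp

theorem ae_mem_cond_uniform_Ioo {a b : ℝ} (h0 : 0 ≤ a) (h1 : b ≤ 1) :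
    ∀ᵐ x ∂(ProbabilityTheory.cond (valuationLaw uniformDensity) (Set.Ioo a b)),
      x ∈ Set.Ioo a b := by
  rw [cond_uniform_Ioo h0 h1]
  exact Measure.ae_smul_measure (ae_restrict_mem measurableSet_Ioo) _

theorem integral_cond_uniform_Ioo {a b : ℝ} (h0 : 0 ≤ a) (hab : a < b) (h1 : b ≤ 1)
    (g : ℝ → ℝ) :
    ∫ x, g x ∂(ProbabilityTheory.cond (valuationLaw uniformDensity) (Set.Ioo a b)) =
      (b - a)⁻¹ * ∫ x in a..b, g x := by
  rw [cond_uniform_Ioo h0 h1, integral_smul_measure, intervalIntegral.integral_of_le hab.le,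
    integral_Ioc_eq_integral_Ioo, ENNReal.toReal_inv,
    ENNReal.toReal_ofReal (sub_nonneg.2 hab.le), smul_eq_mul]

theorem integral_mul_sign {a b z : ℝ} (haz : a ≤ z) (hzb : z ≤ b) {g : ℝ → ℝ}
    (hg : Continuous g) :
    ∫ x in a..b, g x * Real.sign (z - x) = (∫ x in a..z, g x) - ∫ x in z..b, g x := by
  have h1 : ∀ᵐ x ∂(volume : Measure ℝ), x ∈ Set.uIoc a z → g x = g x * Real.sign (z - x) := by
    have : ∀ᵐ x ∂(volume : Measure ℝ), x ≠ z := by simp [ae_iff]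
    filter_upwards [this] with x hx hm
    rw [Set.uIoc_of_le haz] at hm
    rw [Real.sign_of_pos (sub_pos.2 (lt_of_le_of_ne hm.2 hx)), mul_one]
  have h2 : ∀ᵐ x ∂(volume : Measure ℝ), x ∈ Set.uIoc z b → -g x = g x * Real.sign (z - x) := by
    filter_upwards with x hm
    rw [Set.uIoc_of_le hzb] at hm
    rw [Real.sign_of_neg (sub_neg.2 hm.1), mul_neg_one]
  have e1 := intervalIntegral.integral_congr_ae h1
  have e2 := intervalIntegral.integral_congr_ae h2
  rw [intervalIntegral.integral_neg] at e2
  rw [← intervalIntegral.integral_add_adjacent_intervals (b := z)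
    ((hg.intervalIntegrable a z).congr_ae ((ae_restrict_iff' measurableSet_uIoc).2 h1))
    ((hg.neg.intervalIntegrable z b).congr_ae ((ae_restrict_iff' measurableSet_uIoc).2 h2)),
    ← e1, ← e2, sub_eq_add_neg]

theorem integral_const_add_mul (c d l u : ℝ) :
    ∫ x in l..u, (c + d * x) = c * (u - l) + d * ((u ^ 2 - l ^ 2) / 2) := by
  rw [intervalIntegral.integral_add (by simp) ((by fun_prop : Continuous fun x : ℝ =>
    d * x).intervalIntegrable _ _), intervalIntegral.integral_const_mul, integral_id,
    intervalIntegral.integral_const, smul_eq_mul, mul_comm c]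

/-! ### Payoffs with uniform valuations -/

/-- A function on an interval with a continuous subgradient `2 * k * (θ - m)` is quadratic. -/
theorem eq_quadratic_of_subgradient {a b k m : ℝ} {V : ℝ → ℝ}
    (h : ∀ x ∈ Set.Icc a b, ∀ y ∈ Set.Icc a b, V y + 2 * k * (y - m) * (x - y) ≤ V x)
    {x y : ℝ} (hx : x ∈ Set.Icc a b) (hy : y ∈ Set.Icc a b) :
    V x - k * (x - m) ^ 2 = V y - k * (y - m) ^ 2 := by
  set g : ℝ → ℝ := fun x => V x - k * (x - m) ^ 2 with hg
  -- Using the subgradient inequality in both directions leaves only a second-order error, so `g`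
  -- has derivative zero.
  have hbound : ∀ x ∈ Set.Icc a b, ∀ y ∈ Set.Icc a b, ‖g x - g y‖ ≤ |k| * (x - y) ^ 2 := by
    intro x hx y hy
    have h1 := h x hx y hy
    have h2 := h y hy x hx
    have h3 := le_abs_self k
    have h4 := neg_abs_le k
    rw [Real.norm_eq_abs, abs_le]
    constructor <;> simp only [hg] <;> nlinarith [sq_nonneg (x - y)]
  have hd : ∀ x ∈ Set.Icc a b, HasDerivWithinAt g 0 (Set.Icc a b) x := by
    intro x hx
    rw [hasDerivWithinAt_iff_isLittleO]
    have : (fun x' => g x' - g x - (x' - x) • (0 : ℝ)) =O[nhdsWithin x (Set.Icc a b)]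
        fun x' => (x' - x) ^ 2 := by
      refine Asymptotics.IsBigO.of_bound |k| ?_
      filter_upwards [self_mem_nhdsWithin] with x' hx'
      simpa using hbound x' hx' x hx
    refine this.trans_isLittleO ?_
    have h2 := (Asymptotics.isLittleO_pow_id (𝕜 := ℝ) (one_lt_two)).comp_tendsto
      (k := fun x' => x' - x) (l' := nhdsWithin x (Set.Icc a b)) (by
        refine tendsto_nhdsWithin_of_tendsto_nhds ?_
        simpa using (continuous_id.sub continuous_const).tendsto x (f := fun x' => x' - x))
    exact h2
  have := (convex_Icc a b).norm_image_sub_le_of_norm_hasDerivWithin_le (C := 0) hd (by simp) hy hx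
  simpa [sub_eq_zero] using this

/-- The equilibrium payoffs in a double auction among bidders with uniform valuations. -/
theorem uniform_auction_payoffs {a b : ℝ} (h0 : 0 ≤ a) (hab : a < b) (h1 : b ≤ 1) {X V : ℝ → ℝ}
    {μ : Measure ℝ}
    (hμ : μ = ProbabilityTheory.cond (valuationLaw uniformDensity) (Set.Ioo a b))
    (hX : Integrable X μ)
    (hV : ∀ θ, V θ = ∫ x, doubleAuctionGain θ (X θ) (X x) ∂μ)
    (hopt : ∀ θ ∈ Set.Icc (0 : ℝ) 1, ∀ β, ∫ x, doubleAuctionGain θ β (X x) ∂μ ≤ V θ) :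
    V a = (b - a) / 3 ∧ V b = (b - a) / 3 ∧ V ((a + b) / 2) = (b - a) / 12 ∧
      (∀ θ ∈ Set.Icc (0 : ℝ) 1, (b - a) / 12 ≤ V θ) ∧
      (∀ θ ∈ Set.Icc (0 : ℝ) 1, ∀ θ' ∈ Set.Icc (0 : ℝ) 1, V θ' ≤ V θ + |θ' - θ|) ∧
      (∀ θ ∈ Set.Icc (0 : ℝ) 1, (b - a) / 3 + (a - θ) ≤ V θ) ∧
      (∀ θ ∈ Set.Icc (0 : ℝ) 1, (b - a) / 3 + (θ - b) ≤ V θ) := by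
  have : IsProbabilityMeasure μ := hμ ▸ isProbabilityMeasure_cond_uniform_Ioo h0 hab h1
  have : NullSingletonClass μ := hμ ▸ nullSingletonClass_cond_uniform_Ioo h0 h1
  have hsub : Set.Icc a b ⊆ Set.Icc 0 1 := Set.Icc_subset_Icc h0 h1
  have hmem : ∀ᵐ x ∂μ, x ∈ Set.Ioo a b := hμ ▸ ae_mem_cond_uniform_Ioo h0 h1
  have hI : ∀ᵐ x ∂μ, x ∈ Set.Icc (0 : ℝ) 1 := by
    filter_upwards [hmem] with x hx
    exact hsub (Set.Ioo_subset_Icc_self hx)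
  have hd : 0 < b - a := sub_pos.2 hab
  replace hopt : ∀ θ ∈ Set.Icc (0 : ℝ) 1, ∀ β, ∫ x, doubleAuctionGain θ β (X x) ∂μ ≤
      ∫ x, doubleAuctionGain θ (X θ) (X x) ∂μ := fun θ hθ β => (hopt θ hθ β).trans_eq (hV θ)
  set w : ℝ → ℝ := fun θ => ∫ x, Real.sign (X θ - X x) ∂μ with hw
  have hsg : ∀ θ ∈ Set.Icc (0 : ℝ) 1, ∀ θ', V θ' + w θ' * (θ - θ') ≤ V θ := by
    intro θ hθ θ'
    rw [hV, hV]
    exact payoff_subgradient hX hopt hθ θ'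
  have hwI : ∀ θ ∈ Set.Icc a b, w θ = 2 * (b - a)⁻¹ * (θ - (a + b) / 2) := by
    intro θ hθ
    simp only [hw]
    rw [integral_congr_ae (sign_bid_sub_ae_eq hX hI hopt (hsub hθ)), hμ,
      integral_cond_uniform_Ioo h0 hab h1]
    have := integral_mul_sign hθ.1 hθ.2 (continuous_const (y := (1 : ℝ)))
    simp only [one_mul, intervalIntegral.integral_const, smul_eq_mul, mul_one] at this
    rw [this]; ring
  have hquad : ∀ θ ∈ Set.Icc a b,
      V θ = V ((a + b) / 2) + (b - a)⁻¹ * (θ - (a + b) / 2) ^ 2 := by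
    intro θ hθ
    have hm : (a + b) / 2 ∈ Set.Icc a b := ⟨by linarith, by linarith⟩
    have := eq_quadratic_of_subgradient (k := (b - a)⁻¹) (m := (a + b) / 2) (V := V)
      (fun x hx y hy => by
        have := hsg x (hsub hx) y
        rwa [hwI y hy] at this) hθ hm
    simp only [sub_self] at this
    linarith
  -- Budget balance fixes the remaining constant: the expected payment of type `x` is `x * w x - V
  -- x`, and its mean is zero.
  have hVm : V ((a + b) / 2) = (b - a) / 12 := by
    have hbal := integral_integral_payment_eq_zero hX
    have hpay : (fun x => ∫ y, (X x + X y) / 2 * Real.sign (X x - X y) ∂μ) =ᵐ[μ]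
        fun x => x * (2 * (b - a)⁻¹ * (x - (a + b) / 2)) -
          (V ((a + b) / 2) + (b - a)⁻¹ * (x - (a + b) / 2) ^ 2) := by
      filter_upwards [hmem] with x hx
      have hx' := Set.Ioo_subset_Icc_self hx
      rw [← hwI x hx', ← hquad x hx', hV, integral_doubleAuctionGain hX]
      simp only [hw]; ring
    rw [integral_congr_ae hpay, hμ, integral_cond_uniform_Ioo h0 hab h1] at hbal
    have hint : ∫ x in a..b, (x * (2 * (b - a)⁻¹ * (x - (a + b) / 2)) -
          (V ((a + b) / 2) + (b - a)⁻¹ * (x - (a + b) / 2) ^ 2)) =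
        (b - a)⁻¹ * ((b ^ 3 - a ^ 3) / 3) -
          (V ((a + b) / 2) + (b - a)⁻¹ * ((a + b) / 2) ^ 2) * (b - a) := by
      have : ∀ x : ℝ, x * (2 * (b - a)⁻¹ * (x - (a + b) / 2)) -
          (V ((a + b) / 2) + (b - a)⁻¹ * (x - (a + b) / 2) ^ 2) =
          (b - a)⁻¹ * x ^ 2 - (V ((a + b) / 2) + (b - a)⁻¹ * ((a + b) / 2) ^ 2) := by
        intro x; ring
      simp_rw [this]
      rw [intervalIntegral.integral_sub ((by fun_prop : Continuous fun x : ℝ =>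
        (b - a)⁻¹ * x ^ 2).intervalIntegrable _ _) (by simp),
        intervalIntegral.integral_const_mul, integral_pow, intervalIntegral.integral_const]
      simp only [smul_eq_mul]; push_cast; ring
    rw [hint] at hbal
    field_simp at hbal
    have hprod : (b - a) ^ 2 * ((b - a) - 12 * V ((a + b) / 2)) = 0 := by
      linear_combination hbal
    have := (mul_eq_zero.1 hprod).resolve_left (pow_pos hd 2).ne'
    linarith
  have hVa : V a = (b - a) / 3 := by
    rw [hquad a ⟨le_rfl, hab.le⟩, hVm]; field_simp; ring
  have hVb : V b = (b - a) / 3 := by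
    rw [hquad b ⟨hab.le, le_rfl⟩, hVm]; field_simp; ring
  have hwa : w a = -1 := by
    rw [hwI a ⟨le_rfl, hab.le⟩]; field_simp; ring
  have hwb : w b = 1 := by
    rw [hwI b ⟨hab.le, le_rfl⟩]; field_simp; ring
  refine ⟨hVa, hVb, hVm, ?_, ?_, ?_, ?_⟩
  · intro θ hθ
    have := hsg θ hθ ((a + b) / 2)
    rw [hwI _ ⟨by linarith, by linarith⟩, hVm] at this
    linarith
  · intro θ hθ θ' _
    have h2 := hsg θ hθ θ'
    have h3 : |w θ'| ≤ 1 := abs_le.2 (integral_sign_bounds X (X θ'))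
    have h4 : |w θ' * (θ - θ')| ≤ |θ' - θ| := by
      rw [abs_mul, abs_sub_comm θ]
      exact mul_le_of_le_one_left (abs_nonneg _) h3
    have := neg_abs_le (w θ' * (θ - θ'))
    linarith
  · intro θ hθ
    have := hsg θ hθ a
    rw [hwa, hVa] at this; linarith
  · intro θ hθ
    have := hsg θ hθ b
    rw [hwb, hVb] at this; linarith

namespace MarketOutcome

/-! ### Properties of simple outcomes -/

theorem setIntegral_joiners (O : MarketOutcome) (c : MarketChoice) (g : ℝ → ℝ) :
    ∫ θ in O.joiners c, g θ ∂(valuationLaw uniformDensity) = ∫ θ in O.joiners c, g θ := by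
  rw [valuationLaw_uniform, Measure.restrict_restrict_of_subset fun θ hθ => hθ.1]

theorem setIntegral_two_pieces {a b u v : ℝ} (h0 : 0 ≤ a) (hab : a < b) (h1 : b ≤ 1)
    {g : ℝ → ℝ} (hu : ∀ x ∈ Set.Icc 0 a, g x = u) (hv : ∀ x ∈ Set.Icc b 1, g x = v) :
    ∫ x in Set.Icc 0 a ∪ Set.Icc b 1, g x = a * u + (1 - b) * v := by
  have hdisj : Disjoint (Set.Icc 0 a) (Set.Icc b 1) :=
    Set.disjoint_left.2 fun x hx hx' => absurd (hx'.1.trans hx.2) hab.not_ge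
  have hiu : IntegrableOn g (Set.Icc 0 a) :=
    (integrableOn_const (C := u) (by simp)).congr_fun (fun x hx => (hu x hx).symm)
      measurableSet_Icc
  have hiv : IntegrableOn g (Set.Icc b 1) :=
    (integrableOn_const (C := v) (by simp)).congr_fun (fun x hx => (hv x hx).symm)
      measurableSet_Icc
  rw [setIntegral_union hdisj measurableSet_Icc hiu hiv,
    setIntegral_congr_fun measurableSet_Icc hu, setIntegral_congr_fun measurableSet_Icc hv,
    setIntegral_const, setIntegral_const, Real.volume_real_Icc_of_le h0,
    Real.volume_real_Icc_of_le h1]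
  simp

theorem IsMarketEquilibrium.mechanismUtility_eq {f : ℝ → ℝ} {p : ℝ} {O : MarketOutcome}
    (h : O.IsMarketEquilibrium f p) (θ : ℝ) {r : ℝ} (hr : r ∈ Set.Icc (0 : ℝ) 1) :
    O.mechanismUtility θ r = θ * O.q r - O.t r := by
  have hq := h.indivisible r hr
  simp only [Set.mem_insert_iff, Set.mem_singleton_iff] at hq
  rw [mechanismUtility, min_eq_right]
  rcases hq with h | h | h <;> rw [h] <;> norm_num

theorem IsMarketEquilibrium.q_monotoneOn {f : ℝ → ℝ} {p : ℝ} {O : MarketOutcome}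
    (h : O.IsMarketEquilibrium f p) : MonotoneOn O.q (Set.Icc 0 1) := by
  intro x hx y hy hxy
  rcases hxy.eq_or_lt with e | hlt
  · rw [e]
  have h1 := h.incentive_compatible x hx y hy
  have h2 := h.incentive_compatible y hy x hx
  rw [h.mechanismUtility_eq _ hx, h.mechanismUtility_eq _ hy] at h1 h2
  by_contra! hc
  have := mul_pos (sub_pos.2 hlt) (sub_pos.2 hc)
  linarith

theorem IsMarketEquilibrium.integrableOn_q {f : ℝ → ℝ} {p : ℝ} {O : MarketOutcome}
    (h : O.IsMarketEquilibrium f p) : IntegrableOn O.q (Set.Icc 0 1) := by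
  refine Integrable.of_bound (aemeasurable_restrict_of_monotoneOn measurableSet_Icc
    h.q_monotoneOn).aestronglyMeasurable 1 ?_
  filter_upwards [ae_restrict_mem measurableSet_Icc] with x hx
  have hq := h.indivisible x hx
  simp only [Set.mem_insert_iff, Set.mem_singleton_iff] at hq
  rcases hq with h | h | h <;> rw [h] <;> norm_num

/-- All agents who trade the quantity `k` in the mechanism pay the same amount, which is at most
their valuation of that quantity. -/
theorem IsMarketEquilibrium.exists_price {f : ℝ → ℝ} {p : ℝ} {O : MarketOutcome}
    (h : O.IsMarketEquilibrium f p) (k : ℝ) :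
    ∃ P, ∀ θ ∈ O.joiners .mechanism, O.q θ = k → O.t θ = P ∧ P ≤ θ * k := by
  by_cases hr : ∃ r ∈ O.joiners .mechanism, O.q r = k
  · obtain ⟨r, hr, hqr⟩ := hr
    refine ⟨O.t r, fun θ hθ hq => ?_⟩
    have h1 := h.incentive_compatible θ hθ.1 r hr.1
    have h2 := h.incentive_compatible r hr.1 θ hθ.1
    have h3 := h.choice_optimal θ hθ.1 .neither
    rw [hθ.2] at h3
    simp only [payoff] at h3
    rw [h.mechanismUtility_eq _ hθ.1] at h1 h2 h3
    rw [h.mechanismUtility_eq _ hr.1] at h1 h2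
    rw [hq] at h1 h2 h3
    rw [hqr] at h1 h2
    have : O.t θ = O.t r := by linarith
    exact ⟨this, by linarith⟩
  · push Not at hr
    exact ⟨0, fun θ hθ hq => absurd hq (hr θ hθ)⟩

theorem mul_max_le (x : ℝ) : max x 0 * max (1 / 2 - x) 0 ≤ 1 / 16 := by
  rcases le_total x 0 with h | h
  · rw [max_eq_right h]; norm_num
  · rcases le_total (1 / 2 - x) 0 with h' | h'
    · rw [max_eq_right h']; norm_num
    · rw [max_eq_left h, max_eq_left h']; nlinarith [sq_nonneg (x - 1 / 4)]

/-- Individual rationality and market clearing alone bound the profit. -/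
theorem IsMarketEquilibrium.profit_le {p : ℝ} {O : MarketOutcome}
    (h : O.IsMarketEquilibrium uniformDensity p) : O.profit uniformDensity ≤ 1 / 8 := by
  have hclear := h.market_clearing
  have hJ := h.measurable_joiners
  rw [profit, setIntegral_joiners]
  rw [setIntegral_joiners] at hclear
  set J := O.joiners .mechanism with hJdef
  by_cases hint : IntegrableOn O.t J
  swap
  -- If `O.t` is not integrable, the profit is 0 by the convention for integrals.
  · rw [integral_undef hint]; norm_num
  obtain ⟨P, hP⟩ := h.exists_price 1
  obtain ⟨S, hS⟩ := h.exists_price (-1)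
  obtain ⟨N, hN⟩ := h.exists_price 0
  -- The multiplier on market clearing is `1 / 2`, the common value of the virtual cost at `1/4` and
  -- the virtual value at `3/4`. `A` and `B` bound the margins on buyers, who have valuation at
  -- least `P`, and on sellers, who have valuation at most `-S`.
  set A : ℝ → ℝ := (Set.Icc P 1).indicator fun _ => max (P - 1 / 2) 0 with hA
  set B : ℝ → ℝ := (Set.Icc 0 (-S)).indicator fun _ => max (1 / 2 + S) 0 with hB
  have hAi : Integrable A := (integrable_indicator_iff measurableSet_Icc).2
    (integrableOn_const (by simp))
  have hBi : Integrable B := (integrable_indicator_iff measurableSet_Icc).2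
    (integrableOn_const (by simp))
  have hA0 : 0 ≤ A := fun x => Set.indicator_nonneg (fun _ _ => le_max_right _ _) x
  have hB0 : 0 ≤ B := fun x => Set.indicator_nonneg (fun _ _ => le_max_right _ _) x
  have hqi : IntegrableOn O.q J := h.integrableOn_q.mono_set fun θ hθ => hθ.1
  have hpt : ∀ θ ∈ J, O.t θ - O.q θ / 2 ≤ A θ + B θ := by
    intro θ hθ
    have hAθ : 0 ≤ A θ := hA0 θ
    have hBθ : 0 ≤ B θ := hB0 θ
    have hq := h.indivisible θ hθ.1
    simp only [Set.mem_insert_iff, Set.mem_singleton_iff] at hq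
    rcases hq with hq | hq | hq
    · obtain ⟨h1, h2⟩ := hS θ hθ hq
      have : B θ = max (1 / 2 + S) 0 :=
        Set.indicator_of_mem (show θ ∈ Set.Icc 0 (-S) from ⟨hθ.1.1, by linarith⟩) _
      have := le_max_left (1 / 2 + S) 0
      rw [hq, h1]; linarith
    · obtain ⟨h1, h2⟩ := hN θ hθ hq
      rw [hq, h1]; linarith
    · obtain ⟨h1, h2⟩ := hP θ hθ hq
      have : A θ = max (P - 1 / 2) 0 :=
        Set.indicator_of_mem (show θ ∈ Set.Icc P 1 from ⟨by linarith, hθ.1.2⟩) _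
      have := le_max_left (P - 1 / 2) 0
      rw [hq, h1]; linarith
  have hle := setIntegral_mono_on (hint.sub (hqi.div_const 2))
    (hAi.add hBi).integrableOn hJ hpt
  have hle2 := setIntegral_le_integral (s := J) (hAi.add hBi)
    (Filter.Eventually.of_forall fun x => add_nonneg (hA0 x) (hB0 x))
  simp only [Pi.add_apply, Pi.sub_apply] at hle hle2
  rw [integral_sub hint (hqi.div_const 2), integral_div] at hle
  rw [integral_add hAi hBi, hA, hB, integral_indicator_const _ measurableSet_Icc,
    integral_indicator_const _ measurableSet_Icc, Real.volume_real_Icc, Real.volume_real_Icc,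
    smul_eq_mul, smul_eq_mul] at hle2
  have e1 := mul_max_le (1 - P)
  have e2 := mul_max_le (-S)
  rw [show 1 / 2 - (1 - P) = P - 1 / 2 by ring] at e1
  rw [show 1 / 2 - -S = 1 / 2 + S by ring] at e2
  rw [sub_zero] at hle2
  linarith

/-- If matches in the decentralized market occur with positive probability, then its size
determines who joins the mechanism, the market clearing condition and the profit. -/
theorem IsSimpleOutcome.structure_of_pos {p a b : ℝ} {O : MarketOutcome} (hp : 0 < p)
    (hp1 : p ≤ 1) (h : O.IsSimpleOutcome uniformDensity p a b) :
    O.joiners .mechanism = Set.Icc 0 a ∪ Set.Icc b 1 ∧ 1 - b ≤ a ∧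
      O.profit uniformDensity =
        (1 - b) * (b - p * (b - a) / 3) - a * (a + p * (b - a) / 3) := by
  obtain ⟨heq, h0, hab, h1, hs⟩ := h
  set V : ℝ → ℝ := fun θ => O.auctionPayoff uniformDensity θ (O.bid θ) with hV
  have hμ : O.partnerLaw uniformDensity =
      ProbabilityTheory.cond (valuationLaw uniformDensity) (Set.Ioo a b) := by
    rw [partnerLaw, hs]
  obtain ⟨hVa, hVb, hVm, hVmin, hVlip, hVlo, hVhi⟩ := uniform_auction_payoffs (V := V) h0 hab h1
    hμ heq.integrable_bid (fun θ => rfl) heq.bid_optimal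
  have hdpos : 0 < b - a := sub_pos.2 hab
  have hpd : 0 < p * (b - a) := mul_pos hp hdpos
  have ha1 : a ∈ Set.Icc (0 : ℝ) 1 := ⟨h0, hab.le.trans h1⟩
  have hb1 : b ∈ Set.Icc (0 : ℝ) 1 := ⟨h0.trans hab.le, h1⟩
  have hmem : ∀ θ, θ ∈ O.joiners .doubleAuction ↔ θ ∈ Set.Ioo a b := fun θ => by rw [hs]
  have hJ : O.joiners .mechanism = Set.Icc 0 a ∪ Set.Icc b 1 := by
    ext θ
    constructor
    · rintro ⟨hθ, hc⟩
      rcases le_or_gt θ a with hθa | hθa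
      · exact Or.inl ⟨hθ.1, hθa⟩
      rcases le_or_gt b θ with hθb | hθb
      · exact Or.inr ⟨hθb, hθ.2⟩
      have := ((hmem θ).2 ⟨hθa, hθb⟩).2
      rw [hc] at this
      cases this
    · intro hθ
      have hθ1 : θ ∈ Set.Icc (0 : ℝ) 1 := by
        rcases hθ with hθ | hθ
        · exact ⟨hθ.1, hθ.2.trans ha1.2⟩
        · exact ⟨hb1.1.trans hθ.1, hθ.2⟩
      refine ⟨hθ1, ?_⟩
      cases hc : O.choice θ with
      | mechanism => rfl
      | doubleAuction =>
        have := (hmem θ).1 ⟨hθ1, hc⟩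
        rcases hθ with hθ | hθ
        · exact absurd this.1 hθ.2.not_gt
        · exact absurd this.2 hθ.1.not_gt
      | neither =>
        have h2 := heq.choice_optimal θ hθ1 .doubleAuction
        rw [hc] at h2
        have h3 : p * V θ ≤ 0 := h2
        have h4 := mul_pos hp ((by linarith : (0 : ℝ) < (b - a) / 12).trans_le (hVmin θ hθ1))
        exact absurd h3 h4.not_ge
  have hIR : ∀ θ ∈ O.joiners .mechanism, p * V θ ≤ θ * O.q θ - O.t θ := by
    intro θ hθ
    have h2 := heq.choice_optimal θ hθ.1 .doubleAuction
    rw [hθ.2] at h2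
    rw [← heq.mechanismUtility_eq θ hθ.1]
    exact h2
  have hIC : ∀ x ∈ Set.Ioo a b, ∀ θ ∈ Set.Icc (0 : ℝ) 1, x * O.q θ - O.t θ ≤ p * V x := by
    intro x hx θ hθ
    have hx' := (hmem x).2 hx
    have h2 := heq.choice_optimal x hx'.1 .mechanism
    rw [hx'.2] at h2
    rw [← heq.mechanismUtility_eq x hθ]
    exact (heq.incentive_compatible x hx'.1 θ hθ).trans h2
  -- The midpoint type has the lowest payoff from search. Comparing its incentive constraint with
  -- the participation constraint of a type outside `(a, b)` forces the sign of that type's trade.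
  have hm : (a + b) / 2 ∈ Set.Ioo a b := ⟨by linarith, by linarith⟩
  have hq1 : ∀ θ ∈ Set.Icc b 1, O.q θ = 1 := by
    intro θ hθ
    have hθJ : θ ∈ O.joiners .mechanism := by rw [hJ]; exact Or.inr hθ
    have e1 := hIR θ hθJ
    have e2 := hIC _ hm θ hθJ.1
    rw [hVm] at e2
    have e3 := mul_le_mul_of_nonneg_left (hVhi θ hθJ.1) hp.le
    have e4 : 0 ≤ p * (θ - b) := mul_nonneg hp.le (sub_nonneg.2 hθ.1)
    have hpos : 0 < θ - (a + b) / 2 := by linarith [hθ.1]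
    have hq := heq.indivisible θ hθJ.1
    simp only [Set.mem_insert_iff, Set.mem_singleton_iff] at hq
    rcases hq with hq | hq | hq
    · rw [hq] at e1 e2; linarith
    · rw [hq] at e1 e2; linarith
    · exact hq
  have hq2 : ∀ θ ∈ Set.Icc 0 a, O.q θ = -1 := by
    intro θ hθ
    have hθJ : θ ∈ O.joiners .mechanism := by rw [hJ]; exact Or.inl hθ
    have e1 := hIR θ hθJ
    have e2 := hIC _ hm θ hθJ.1
    rw [hVm] at e2
    have e3 := mul_le_mul_of_nonneg_left (hVlo θ hθJ.1) hp.le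
    have e4 : 0 ≤ p * (a - θ) := mul_nonneg hp.le (sub_nonneg.2 hθ.2)
    have hpos : 0 < (a + b) / 2 - θ := by linarith [hθ.2]
    have hq := heq.indivisible θ hθJ.1
    simp only [Set.mem_insert_iff, Set.mem_singleton_iff] at hq
    rcases hq with hq | hq | hq
    · exact hq
    · rw [hq] at e1 e2; linarith
    · rw [hq] at e1 e2; linarith
  have hbJ : b ∈ O.joiners .mechanism := by rw [hJ]; exact Or.inr ⟨le_rfl, h1⟩
  have haJ : a ∈ O.joiners .mechanism := by rw [hJ]; exact Or.inl ⟨h0, le_rfl⟩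
  have ht1 : ∀ θ ∈ Set.Icc b 1, O.t θ = b - p * (b - a) / 3 := by
    intro θ hθ
    have hθJ : θ ∈ O.joiners .mechanism := by rw [hJ]; exact Or.inr hθ
    have e1 := hIR b hbJ
    have e2 := heq.incentive_compatible θ hθJ.1 b hbJ.1
    rw [heq.mechanismUtility_eq _ hθJ.1, heq.mechanismUtility_eq _ hbJ.1, hq1 θ hθ,
      hq1 b ⟨le_rfl, h1⟩] at e2
    rw [hq1 b ⟨le_rfl, h1⟩, hVb] at e1
    refine le_antisymm (by linarith) ?_
    by_contra! hc
    -- At a lower price, types just below `b` would leave the decentralized market: `p * V` falls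
    -- short of `p * V b` or exceeds it by at most `b - x`, since `V` is 1-Lipschitz and `p ≤ 1`.
    obtain ⟨x, hx1, hx2⟩ := exists_between (max_lt hab
      (show (O.t θ + b + p * (b - a) / 3) / 2 < b by linarith))
    rw [max_lt_iff] at hx1
    have e3 := hIC x ⟨hx1.1, hx2⟩ θ hθJ.1
    have e4 := hVlip b hb1 x ⟨h0.trans hx1.1.le, hx2.le.trans h1⟩
    rw [hVb, abs_of_neg (sub_neg.2 hx2)] at e4
    have e5 := mul_le_mul_of_nonneg_left e4 hp.le
    have e6 := mul_le_mul_of_nonneg_right hp1 (sub_nonneg.2 hx2.le)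
    rw [hq1 θ hθ] at e3
    linarith [hx1.2]
  have ht2 : ∀ θ ∈ Set.Icc 0 a, O.t θ = -(a + p * (b - a) / 3) := by
    intro θ hθ
    have hθJ : θ ∈ O.joiners .mechanism := by rw [hJ]; exact Or.inl hθ
    have e1 := hIR a haJ
    have e2 := heq.incentive_compatible θ hθJ.1 a haJ.1
    rw [heq.mechanismUtility_eq _ hθJ.1, heq.mechanismUtility_eq _ haJ.1, hq2 θ hθ,
      hq2 a ⟨h0, le_rfl⟩] at e2
    rw [hq2 a ⟨h0, le_rfl⟩, hVa] at e1
    refine le_antisymm (by linarith) ?_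
    by_contra! hc
    obtain ⟨x, hx1, hx2⟩ := exists_between (lt_min hab
      (show a < (a - O.t θ - p * (b - a) / 3) / 2 by linarith))
    rw [lt_min_iff] at hx2
    have e3 := hIC x ⟨hx1, hx2.1⟩ θ hθJ.1
    have e4 := hVlip a ha1 x ⟨h0.trans hx1.le, hx2.1.le.trans h1⟩
    rw [hVa, abs_of_pos (sub_pos.2 hx1)] at e4
    have e5 := mul_le_mul_of_nonneg_left e4 hp.le
    have e6 := mul_le_mul_of_nonneg_right hp1 (sub_nonneg.2 hx1.le)
    rw [hq2 θ hθ] at e3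
    linarith [hx2.2]
  refine ⟨hJ, ?_, ?_⟩
  · have hclear := heq.market_clearing
    rw [setIntegral_joiners, hJ, setIntegral_two_pieces h0 hab h1 hq2 hq1] at hclear
    linarith
  · rw [profit, setIntegral_joiners, hJ, setIntegral_two_pieces h0 hab h1 ht2 ht1]
    ring

/-! ### Optimal cutoffs -/

theorem profit_formula_le {p a b : ℝ} (hp : 0 < p) (hp1 : p ≤ 1) (h1 : b ≤ 1)
    (hc : 1 - b ≤ a) :
    (1 - b) * (b - p * (b - a) / 3) - a * (a + p * (b - a) / 3) ≤ (1 - 2 * p / 3) / 8 ∧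
      ((1 - 2 * p / 3) / 8 ≤ (1 - b) * (b - p * (b - a) / 3) - a * (a + p * (b - a) / 3) →
        a = 1 / 4 ∧ b = 3 / 4) := by
  -- `s` is the excess supply. In `s` and the sales volume `1 - b`, the profit is the maximum minus
  -- a square and minus `s` times a bracket, which `p > 0` makes strictly positive; hence the
  -- uniqueness.
  obtain ⟨s, hs⟩ : ∃ s, s = a - (1 - b) := ⟨_, rfl⟩
  have hs0 : 0 ≤ s := by linarith
  have hb : b = 1 - a + s := by linarith
  have hid : (1 - b) * (b - p * (b - a) / 3) - a * (a + p * (b - a) / 3) =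
      (1 - 2 * p / 3) / 8 - 2 * (1 - 2 * p / 3) * ((1 - b) - 1 / 4) ^ 2 -
        s * (2 * (1 - b) * (1 - 2 * p / 3) + s * (1 - p / 3) + p / 3) := by
    rw [hs]; ring
  have hk : 0 < 1 - 2 * p / 3 := by linarith
  have hbr : 0 < 2 * (1 - b) * (1 - 2 * p / 3) + s * (1 - p / 3) + p / 3 := by
    have := mul_nonneg (sub_nonneg.2 h1) hk.le
    have := mul_nonneg hs0 (by linarith : 0 ≤ 1 - p / 3)
    linarith
  have e1 := mul_nonneg hs0 hbr.le
  have e2 := mul_nonneg hk.le (sq_nonneg ((1 - b) - 1 / 4))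
  rw [hid]
  refine ⟨by linarith, fun h => ?_⟩
  have e3 : (1 - 2 * p / 3) * ((1 - b) - 1 / 4) ^ 2 = 0 := by linarith
  have e4 : s * (2 * (1 - b) * (1 - 2 * p / 3) + s * (1 - p / 3) + p / 3) = 0 := by linarith
  have e5 := (mul_eq_zero.1 e4).resolve_right hbr.ne'
  have e6 := pow_eq_zero_iff (two_ne_zero) |>.1 ((mul_eq_zero.1 e3).resolve_left hk.ne')
  constructor <;> linarith

end MarketOutcome

namespace MarketOutcome

/-! ### The simple equilibrium -/

/-- The designer offers to sell at `3 / 4 - p / 6` and to buy at `1 / 4 + p / 6`; the types in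
`(1 / 4, 3 / 4)` join the double auction and bid linearly. -/
def candidate (p : ℝ) : MarketOutcome where
  -- Every type is assigned a trade, with the switch at `1 / 2`, where buying and selling are
  -- equally good; this gives incentive compatibility on all of `[0, 1]`.
  q θ := if θ ≤ 1 / 2 then -1 else 1
  t θ := if θ ≤ 1 / 2 then -(1 / 4 + p / 6) else 3 / 4 - p / 6
  choice θ := if 1 / 4 < θ ∧ θ < 3 / 4 then .doubleAuction else .mechanism
  -- The linear equilibrium bid for uniform valuations on `(1/4, 3/4)`. Types outside make the
  -- extreme bids `1/3` and `2/3`.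
  bid θ := 1 / 6 + 2 / 3 * max (1 / 4) (min (3 / 4) θ)

theorem candidate_joiners_doubleAuction (p : ℝ) :
    (candidate p).joiners .doubleAuction = Set.Ioo (1 / 4) (3 / 4) := by
  ext θ
  simp only [joiners, candidate, Set.mem_ofPred_eq, Set.mem_Icc, Set.mem_Ioo]
  constructor
  · rintro ⟨-, h⟩
    by_contra hc
    rw [if_neg hc] at h
    cases h
  · intro h
    exact ⟨⟨by linarith [h.1], by linarith [h.2]⟩, if_pos h⟩

theorem candidate_joiners_mechanism (p : ℝ) :
    (candidate p).joiners .mechanism = Set.Icc 0 (1 / 4) ∪ Set.Icc (3 / 4) 1 := by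
  ext θ
  simp only [joiners, candidate, Set.mem_ofPred_eq, Set.mem_Icc, Set.mem_union]
  constructor
  · rintro ⟨h, hc⟩
    by_cases hθ : 1 / 4 < θ ∧ θ < 3 / 4
    · rw [if_pos hθ] at hc
      cases hc
    · rw [not_and_or, not_lt, not_lt] at hθ
      exact hθ.imp (fun h' => ⟨h.1, h'⟩) fun h' => ⟨h', h.2⟩
  · intro h
    have hθ : ¬ (1 / 4 < θ ∧ θ < 3 / 4) := by
      rintro ⟨h2, h3⟩
      rcases h with h | h <;> linarith [h.1, h.2]
    refine ⟨?_, if_neg hθ⟩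
    rcases h with h | h <;> constructor <;> linarith [h.1, h.2]

theorem candidate_partnerLaw (p : ℝ) : (candidate p).partnerLaw uniformDensity =
    ProbabilityTheory.cond (valuationLaw uniformDensity) (Set.Ioo (1 / 4) (3 / 4)) := by
  rw [partnerLaw, candidate_joiners_doubleAuction]

theorem candidate_bid_of_mem (p : ℝ) {x : ℝ} (hx : x ∈ Set.Icc (1 / 4 : ℝ) (3 / 4)) :
    (candidate p).bid x = 1 / 6 + 2 / 3 * x := by
  simp only [candidate]
  rw [min_eq_right hx.2, max_eq_right hx.1]

theorem candidate_integrable_bid (p : ℝ) :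
    Integrable (candidate p).bid ((candidate p).partnerLaw uniformDensity) := by
  have : IsProbabilityMeasure ((candidate p).partnerLaw uniformDensity) := by
    rw [candidate_partnerLaw]
    exact isProbabilityMeasure_cond_uniform_Ioo (by norm_num) (by norm_num) (by norm_num)
  have hc : Continuous (candidate p).bid := by
    unfold candidate; fun_prop
  refine Integrable.of_bound hc.aestronglyMeasurable 1 ?_
  rw [candidate_partnerLaw]
  filter_upwards [ae_mem_cond_uniform_Ioo (a := 1 / 4) (b := 3 / 4) (by norm_num) (by norm_num)]
    with x hx
  rw [candidate_bid_of_mem p (Set.Ioo_subset_Icc_self hx), Real.norm_eq_abs, abs_le]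
  constructor <;> linarith [hx.1, hx.2]

/-- Bidding as type `z` gives a concave quadratic in `z` with vertex at `z = θ`, so truthful
imitation is best. -/
theorem candidate_auctionPayoff (p θ : ℝ) {z : ℝ} (hz : z ∈ Set.Icc (1 / 4 : ℝ) (3 / 4)) :
    (candidate p).auctionPayoff uniformDensity θ (1 / 6 + 2 / 3 * z) =
      2 * (2 * θ * z - θ - z ^ 2 + 13 / 48) := by
  have hg : ∀ x ∈ Set.uIoc (1 / 4 : ℝ) (3 / 4),
      doubleAuctionGain θ (1 / 6 + 2 / 3 * z) ((candidate p).bid x) =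
        ((θ - 1 / 6 - z / 3) + -1 / 3 * x) * Real.sign (z - x) := by
    intro x hx
    rw [Set.uIoc_of_le (by norm_num)] at hx
    rw [candidate_bid_of_mem p (Set.Ioc_subset_Icc_self hx), doubleAuctionGain]
    rcases lt_trichotomy z x with h | h | h
    · rw [if_neg (by linarith), if_pos (by linarith), Real.sign_of_neg (sub_neg.2 h)]; ring
    · rw [h]; simp
    · rw [if_pos (by linarith), Real.sign_of_pos (sub_pos.2 h)]; ring
  rw [auctionPayoff, candidate_partnerLaw, integral_cond_uniform_Ioo (by norm_num) (by norm_num)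
    (by norm_num), intervalIntegral.integral_congr_ae (Filter.Eventually.of_forall hg),
    integral_mul_sign hz.1 hz.2 (by fun_prop), integral_const_add_mul, integral_const_add_mul]
  ring

theorem candidate_bid_optimal (p θ β : ℝ) :
    (candidate p).auctionPayoff uniformDensity θ β ≤
      (candidate p).auctionPayoff uniformDensity θ ((candidate p).bid θ) := by
  set clamp : ℝ → ℝ := fun x => max (1 / 4) (min (3 / 4) x) with hclamp
  have hmem : ∀ x, clamp x ∈ Set.Icc (1 / 4 : ℝ) (3 / 4) := fun x =>
    ⟨le_max_left _ _, max_le (by norm_num) (min_le_left _ _)⟩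
  -- The type whose bid is `β`, clamped. Bids beyond `[1/3, 2/3]` trade in the same way as the
  -- nearest endpoint but at a worse price, so they are dominated.
  set z := clamp ((β - 1 / 6) * (3 / 2)) with hz
  have h1 : (candidate p).auctionPayoff uniformDensity θ β ≤
      (candidate p).auctionPayoff uniformDensity θ (1 / 6 + 2 / 3 * z) := by
    have : IsProbabilityMeasure ((candidate p).partnerLaw uniformDensity) := by
      rw [candidate_partnerLaw]
      exact isProbabilityMeasure_cond_uniform_Ioo (by norm_num) (by norm_num) (by norm_num)
    refine integral_mono_ae (integrable_doubleAuctionGain (candidate_integrable_bid p) _ _)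
      (integrable_doubleAuctionGain (candidate_integrable_bid p) _ _) ?_
    rw [candidate_partnerLaw]
    filter_upwards [ae_mem_cond_uniform_Ioo (a := 1 / 4) (b := 3 / 4) (by norm_num)
      (by norm_num)] with x hx
    rw [candidate_bid_of_mem p (Set.Ioo_subset_Icc_self hx)]
    have hx1 := hx.1
    have hx2 := hx.2
    rcases lt_or_ge β (1 / 3) with h | h
    · have hz' : z = 1 / 4 := by
        rw [hz, hclamp]; simp only
        rw [min_eq_right (by linarith), max_eq_left (by linarith)]
      rw [hz', doubleAuctionGain, doubleAuctionGain, if_neg (by linarith), if_pos (by linarith),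
        if_neg (by linarith), if_pos (by linarith)]
      linarith
    rcases lt_or_ge (2 / 3) β with h' | h'
    · have hz' : z = 3 / 4 := by
        rw [hz, hclamp]; simp only
        rw [min_eq_left (by linarith), max_eq_right (by norm_num)]
      rw [hz', doubleAuctionGain, doubleAuctionGain, if_pos (by linarith), if_pos (by linarith)]
      linarith
    · have hz' : z = (β - 1 / 6) * (3 / 2) := by
        rw [hz, hclamp]; simp only
        rw [min_eq_right (by linarith), max_eq_right (by linarith)]
      rw [hz', show 1 / 6 + 2 / 3 * ((β - 1 / 6) * (3 / 2)) = β by ring]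
  refine h1.trans ?_
  rw [candidate_auctionPayoff p θ (hmem _), show (candidate p).bid θ = 1 / 6 + 2 / 3 * clamp θ
    from rfl, candidate_auctionPayoff p θ (hmem _)]
  have hzm := hmem ((β - 1 / 6) * (3 / 2))
  rw [← hz] at hzm
  obtain ⟨hz1, hz2⟩ := hzm
  rcases lt_or_ge θ (1 / 4) with h | h
  · have : clamp θ = 1 / 4 := by
      simp only [hclamp]; rw [min_eq_right (by linarith), max_eq_left (by linarith)]
    rw [this]; nlinarith
  rcases lt_or_ge (3 / 4) θ with h' | h'
  · have : clamp θ = 3 / 4 := by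
      simp only [hclamp]; rw [min_eq_left (by linarith), max_eq_right (by norm_num)]
    rw [this]; nlinarith
  · have : clamp θ = θ := by
      simp only [hclamp]; rw [min_eq_right (by linarith), max_eq_right (by linarith)]
    rw [this]; nlinarith [sq_nonneg (θ - z)]

theorem candidate_mechanismUtility (p θ r : ℝ) : (candidate p).mechanismUtility θ r =
    if r ≤ 1 / 2 then 1 / 4 + p / 6 - θ else θ - (3 / 4 - p / 6) := by
  simp only [mechanismUtility, candidate]
  split_ifs
  · rw [min_eq_right (by norm_num)]; ring
  · rw [min_self]; ring

theorem candidate_integrals (p u v : ℝ) :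
    ∫ θ in (candidate p).joiners .mechanism, (if θ ≤ 1 / 2 then u else v)
      ∂(valuationLaw uniformDensity) = (u + v) / 4 := by
  rw [setIntegral_joiners, candidate_joiners_mechanism,
    setIntegral_two_pieces (u := u) (v := v) (by norm_num) (by norm_num) (by norm_num)
      (fun x hx => if_pos (by linarith [hx.2])) (fun x hx => if_neg (by linarith [hx.1]))]
  ring

theorem candidate_profit (p : ℝ) :
    (candidate p).profit uniformDensity = (1 - 2 * p / 3) / 8 := by
  rw [profit]
  refine (candidate_integrals p (-(1 / 4 + p / 6)) (3 / 4 - p / 6)).trans ?_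
  ring

/-- Mechanism and search payoffs agree at `1/4` and `3/4`. The former has slope -1 or 1 on each side
of `1/2`, while `p * V` is 1-Lipschitz, so they cross only in the right direction. -/
theorem candidate_choice_optimal {p : ℝ} (hp : 0 ≤ p) (hp1 : p ≤ 1) {θ : ℝ}
    (hθ : θ ∈ Set.Icc (0 : ℝ) 1) (c : MarketChoice) :
    (candidate p).payoff uniformDensity p θ c ≤
      (candidate p).payoff uniformDensity p θ ((candidate p).choice θ) := by
  set V : ℝ → ℝ := fun θ => (candidate p).auctionPayoff uniformDensity θ ((candidate p).bid θ)
    with hV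
  obtain ⟨hVa, hVb, -, hVmin, hVlip, -, -⟩ := uniform_auction_payoffs (V := V) (a := 1 / 4)
    (b := 3 / 4) (by norm_num) (by norm_num) (by norm_num) (candidate_partnerLaw p)
    (candidate_integrable_bid p) (fun θ => rfl) (fun θ _ β => candidate_bid_optimal p θ β)
  have hVθ := hVmin θ hθ
  have hDA : (candidate p).payoff uniformDensity p θ .doubleAuction = p * V θ := rfl
  have hM : (candidate p).payoff uniformDensity p θ .mechanism =
      if θ ≤ 1 / 2 then 1 / 4 + p / 6 - θ else θ - (3 / 4 - p / 6) :=
    candidate_mechanismUtility p θ θ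
  have hN : (candidate p).payoff uniformDensity p θ .neither = 0 := rfl
  have ha : (1 / 4 : ℝ) ∈ Set.Icc (0 : ℝ) 1 := by constructor <;> norm_num
  have hb : (3 / 4 : ℝ) ∈ Set.Icc (0 : ℝ) 1 := by constructor <;> norm_num
  have lip {x y : ℝ} (d : ℝ) (h : V x ≤ V y + d) (hd : 0 ≤ d) : p * V x ≤ p * V y + d := by
    have := mul_le_mul_of_nonneg_left h hp
    have := mul_le_mul_of_nonneg_right hp1 hd
    linarith
  have hpV : 0 ≤ p * V θ := mul_nonneg hp (by linarith)
  by_cases hin : 1 / 4 < θ ∧ θ < 3 / 4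
  · have hch : (candidate p).choice θ = .doubleAuction := if_pos hin
    rw [hch]
    cases c with
    | doubleAuction => exact le_rfl
    | neither => rw [hDA, hN]; exact hpV
    | mechanism =>
      rw [hDA, hM]
      split_ifs with h
      · have := lip _ (hVlip θ hθ _ ha) (abs_nonneg _)
        rw [hVa, abs_of_neg (by linarith)] at this
        linarith
      · have := lip _ (hVlip θ hθ _ hb) (abs_nonneg _)
        rw [hVb, abs_of_pos (by linarith)] at this
        linarith
  · have hch : (candidate p).choice θ = .mechanism := if_neg hin
    rw [hch, hM]
    rw [not_and_or, not_lt, not_lt] at hin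
    have hle : p * V θ ≤ if θ ≤ 1 / 2 then 1 / 4 + p / 6 - θ else θ - (3 / 4 - p / 6) := by
      rcases hin with h | h
      · rw [if_pos (by linarith)]
        have := lip _ (hVlip _ ha θ hθ) (abs_nonneg _)
        rw [hVa, abs_of_nonpos (by linarith)] at this
        linarith
      · rw [if_neg (by linarith)]
        have := lip _ (hVlip _ hb θ hθ) (abs_nonneg _)
        rw [hVb, abs_of_nonneg (by linarith)] at this
        linarith
    cases c with
    | doubleAuction => rw [hDA]; exact hle
    | neither => rw [hN]; exact hpV.trans hle
    | mechanism => rw [hM]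

theorem candidate_isSimpleOutcome {p : ℝ} (hp : 0 ≤ p) (hp1 : p ≤ 1) :
    (candidate p).IsSimpleOutcome uniformDensity p (1 / 4) (3 / 4) where
  nonneg := by norm_num
  lt := by norm_num
  le_one := by norm_num
  searchers := candidate_joiners_doubleAuction p
  equilibrium := {
    indivisible := fun θ _ => by
      simp only [candidate]
      split_ifs <;> simp
    incentive_compatible := fun θ _ r _ => by
      rw [candidate_mechanismUtility, candidate_mechanismUtility]
      split_ifs <;> linarith
    measurable_joiners := by
      rw [candidate_joiners_mechanism]
      exact measurableSet_Icc.union measurableSet_Icc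
    market_clearing := by
      refine (candidate_integrals p (-1) 1).trans_le ?_
      norm_num
    integrable_bid := candidate_integrable_bid p
    bid_optimal := fun θ _ β => candidate_bid_optimal p θ β
    choice_optimal := fun θ hθ c => candidate_choice_optimal hp hp1 hθ c
    -- A pair has measure zero and leaves payoffs unchanged, so individual optimality already
    -- excludes joint gains.
    no_bilateral_deviation := fun θ hθ _ _ c h =>
      absurd h.1 (candidate_choice_optimal hp hp1 hθ c).not_gt }

theorem candidate_isSimpleEquilibrium {p : ℝ} (hp : 0 ≤ p) (hp1 : p ≤ 1) :
    (candidate p).IsSimpleEquilibrium uniformDensity p (1 / 4) (3 / 4) where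
  simple := candidate_isSimpleOutcome hp hp1
  profit_maximal := by
    intro a b O hO
    rw [candidate_profit]
    rcases hp.eq_or_lt with rfl | hpos
    · have := hO.equilibrium.profit_le
      linarith
    · obtain ⟨-, hc, hprofit⟩ := hO.structure_of_pos hpos hp1
      rw [hprofit]
      exact (profit_formula_le hpos hp1 hO.le_one hc).1

end MarketOutcome

end

theorem mainTheorem11 :
    ∃ a b : ℝ, 0 < a ∧ a < b ∧ b < 1 ∧
      virtualCost uniformDensity a = virtualValue uniformDensity b ∧
      valuationCDF uniformDensity a = 1 - valuationCDF uniformDensity b ∧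
      (∀ p : ℝ, 0 ≤ p → p ≤ 1 → ∃ O : MarketOutcome,
        O.IsSimpleEquilibrium uniformDensity p a b ∧
        O.joiners .mechanism = Set.Icc 0 a ∪ Set.Icc b 1 ∧
        O.joiners .doubleAuction = Set.Ioo a b) ∧
      (∀ p : ℝ, 0 < p → p ≤ 1 → ∀ (a' b' : ℝ) (O : MarketOutcome),
        O.IsSimpleEquilibrium uniformDensity p a' b' →
        a' = a ∧ b' = b ∧
        O.joiners .mechanism = Set.Icc 0 a ∪ Set.Icc b 1 ∧
        O.joiners .doubleAuction = Set.Ioo a b) := by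
  have hFa := valuationCDF_uniform (x := 1 / 4) (by norm_num) (by norm_num)
  have hFb := valuationCDF_uniform (x := 3 / 4) (by norm_num) (by norm_num)
  -- For the uniform law the two equations read `2a = 2b - 1` and `a = 1 - b`.
  refine ⟨1 / 4, 3 / 4, by norm_num, by norm_num, by norm_num, ?_, ?_, ?_, ?_⟩
  · rw [virtualCost, virtualValue, hFa, hFb, uniformDensity_eq_one (by norm_num) (by norm_num),
      uniformDensity_eq_one (by norm_num) (by norm_num)]
    norm_num
  · rw [hFa, hFb]; norm_num
  · intro p hp hp1
    exact ⟨MarketOutcome.candidate p, MarketOutcome.candidate_isSimpleEquilibrium hp hp1,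
      MarketOutcome.candidate_joiners_mechanism p, MarketOutcome.candidate_joiners_doubleAuction p⟩
  · intro p hp hp1 a b O hO
    obtain ⟨hJ, hc, hprofit⟩ := hO.simple.structure_of_pos hp hp1
    have hmax := hO.profit_maximal _ _ _ (MarketOutcome.candidate_isSimpleOutcome hp.le hp1)
    rw [MarketOutcome.candidate_profit, hprofit] at hmax
    obtain ⟨rfl, rfl⟩ :=
      (MarketOutcome.profit_formula_le hp hp1 hO.simple.le_one hc).2 hmax
    exact ⟨rfl, rfl, hJ, hO.simple.searchers⟩
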